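/- Let $\mathfrak p$ be the least cardinality of a family $\mathcal F$ of subsets of $\omega$ such that every finite subfamily of $\mathcal F$ has infinite intersection but no infinite $P\subset\omega$ has $P\setminus B$ finite for all $B\in\mathcal F$. For a family $\mathcal U$ of subsets of a space $S$ and $A\subset S$ put $St(A,\mathcal U)=\bigcup\{U\in\mathcal U: U\cap A\neq\emptyset\}$. The space $S$ is in countable discrete web if for every open cover $\mathcal U$ of $S$ there is a countable closed discrete $A\subset S$ with $St(A,\mathcal U)=S$; it is an (a)-space if for every open cover $\mathcal U$ and every dense $Y\subset S$ there is $A\subset Y$, closed in $S$ and discrete, with $St(A,\mathcal U)=S$. The extent $e(S)$ is the supremum of $\aleph_0$ and the cardinalities of the closed discrete subsets of $S$. Normal spaces are assumed to be $T_1$. Assume $\omega_1<\mathfrak p$. Then there is a normal space $S$ in countable discrete web with $e(S)=\omega_1$. More precisely: (1) For every $X\subset\mathbb R$ with $|X|=\omega_1$, the subspace $Y_X=(X\times\{0\})\cup(\mathbb R\times(0,1))$ of the Moore–Niemytzki plane (the closed upper half-plane with the tangent disc topology) is a normal separable (a)-space, is in countable discrete web, and satisfies $e(Y_X)=\omega_1$.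 (2) For every almost disjoint family $\mathcal A$ of infinite subsets of $\omega$ with $|\mathcal A|=\omega_1$, the space $\Psi(\mathcal A)=\omega\cup\mathcal A$ (points of $\omega$ are isolated; basic neighbourhoods of $A\in\mathcal A$ are the sets $\{A\}\cup(A\setminus K)$ with $K$ finite) is a separable (a)-space, is in countable discrete web, and satisfies $e(\Psi(\mathcal A))=\omega_1$; and there is such a family $\mathcal A$ for which $\Psi(\mathcal A)$ is in addition normal. -/

import Mathlib

open scoped Cardinal

/-- The pseudo-intersection number `𝔭`: the least cardinality of a family `F` of subsets of `ℕ`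
such that every finite subfamily of `F` has infinite intersection, but no infinite `P ⊆ ℕ`
is almost contained in every member of `F`. -/
noncomputable def pseudoIntersectionNumber : Cardinal.{0} :=
  sInf {κ : Cardinal.{0} | ∃ F : Set (Set ℕ), #F = κ ∧
    (∀ G : Set (Set ℕ), G ⊆ F → G.Finite → (⋂₀ G).Infinite) ∧
    ¬ ∃ P : Set ℕ, P.Infinite ∧ ∀ B ∈ F, (P \ B).Finite}

/-- `U` is an open cover of `X`. -/
def IsOpenCovering {X : Type*} [TopologicalSpace X] (U : Set (Set X)) : Prop :=
  (∀ O ∈ U, IsOpen O) ∧ ⋃₀ U = Set.univ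

/-- The star `St(A, U)` of a set `A` with respect to a family `U`. -/
def starOf {X : Type*} (A : Set X) (U : Set (Set X)) : Set X :=
  ⋃₀ {O ∈ U | (O ∩ A).Nonempty}

/-- `X` is in countable discrete web. -/
def InCountableDiscreteWeb (X : Type*) [TopologicalSpace X] : Prop :=
  ∀ U : Set (Set X), IsOpenCovering U →
    ∃ A : Set X, A.Countable ∧ IsClosed A ∧ IsDiscrete A ∧ starOf A U = Set.univ

/-- `X` is an (a)-space. -/
def IsASpace (X : Type*) [TopologicalSpace X] : Prop :=
  ∀ U : Set (Set X), IsOpenCovering U → ∀ Y : Set X, Dense Y →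
    ∃ A : Set X, A ⊆ Y ∧ IsClosed A ∧ IsDiscrete A ∧ starOf A U = Set.univ

/-- The extent `e(X)`: the supremum of `ℵ₀` and of the cardinalities of the closed discrete
subsets of `X`. -/
noncomputable def extent (X : Type*) [TopologicalSpace X] : Cardinal :=
  max ℵ₀ (⨆ D : {D : Set X // IsClosed D ∧ IsDiscrete D}, #D.1)

/-- The points of the Moore–Niemytzki plane: the closed upper half-plane. -/
@[ext]
structure NiemytzkiPlane where
  x : ℝ
  y : ℝ
  y_nonneg : 0 ≤ y

namespace NiemytzkiPlane

/-- The open Euclidean disc with centre `(a, b)` and radius `r`, within the closed upper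
half-plane. -/
def disc (a b r : ℝ) : Set NiemytzkiPlane :=
  {q | (q.x - a) ^ 2 + (q.y - b) ^ 2 < r ^ 2}

theorem disc_subset_of_le {a b r s : ℝ} (hr : 0 < r) (h : r ≤ s) : disc a b r ⊆ disc a b s := by
  intro q hq
  have hq' : (q.x - a) ^ 2 + (q.y - b) ^ 2 < r ^ 2 := hq
  show (q.x - a) ^ 2 + (q.y - b) ^ 2 < s ^ 2
  nlinarith

theorem tangent_subset_of_le {a r s : ℝ} (h : r ≤ s) : disc a r r ⊆ disc a s s := by
  intro q hq
  have hq' : (q.x - a) ^ 2 + (q.y - r) ^ 2 < r ^ 2 := hq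
  show (q.x - a) ^ 2 + (q.y - s) ^ 2 < s ^ 2
  nlinarith [mul_nonneg q.y_nonneg (sub_nonneg.2 h)]

/-- The Moore–Niemytzki (tangent disc) topology: points with `y > 0` have their Euclidean
neighbourhoods; a basic neighbourhood of `(a, 0)` is `{(a, 0)}` together with an open disc
in the upper half-plane tangent to the axis at `(a, 0)`. -/
instance : TopologicalSpace NiemytzkiPlane where
  IsOpen U := ∀ p ∈ U,
    (0 < p.y → ∃ r : ℝ, 0 < r ∧ disc p.x p.y r ⊆ U) ∧
    (p.y = 0 → ∃ r : ℝ, 0 < r ∧ disc p.x r r ⊆ U)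
  isOpen_univ := fun _ _ =>
    ⟨fun _ => ⟨1, one_pos, Set.subset_univ _⟩, fun _ => ⟨1, one_pos, Set.subset_univ _⟩⟩
  isOpen_inter := by
    intro U V hU hV p hp
    refine ⟨fun h => ?_, fun h => ?_⟩
    · obtain ⟨r, hr, hrU⟩ := (hU p hp.1).1 h
      obtain ⟨s, hs, hsV⟩ := (hV p hp.2).1 h
      exact ⟨min r s, lt_min hr hs, Set.subset_inter
        ((disc_subset_of_le (lt_min hr hs) (min_le_left r s)).trans hrU)
        ((disc_subset_of_le (lt_min hr hs) (min_le_right r s)).trans hsV)⟩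
    · obtain ⟨r, hr, hrU⟩ := (hU p hp.1).2 h
      obtain ⟨s, hs, hsV⟩ := (hV p hp.2).2 h
      exact ⟨min r s, lt_min hr hs, Set.subset_inter
        ((tangent_subset_of_le (min_le_left r s)).trans hrU)
        ((tangent_subset_of_le (min_le_right r s)).trans hsV)⟩
  isOpen_sUnion := by
    intro S hS p hp
    obtain ⟨U, hU, hpU⟩ := hp
    refine ⟨fun h => ?_, fun h => ?_⟩
    · obtain ⟨r, hr, hrU⟩ := (hS U hU p hpU).1 h
      exact ⟨r, hr, hrU.trans (Set.subset_sUnion_of_mem hU)⟩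
    · obtain ⟨r, hr, hrU⟩ := (hS U hU p hpU).2 h
      exact ⟨r, hr, hrU.trans (Set.subset_sUnion_of_mem hU)⟩

/-- The set `Y_X = (X × {0}) ∪ (ℝ × (0, 1))`; as a type it carries the subspace topology. -/
def strip (X : Set ℝ) : Set NiemytzkiPlane :=
  {p | (p.x ∈ X ∧ p.y = 0) ∨ (0 < p.y ∧ p.y < 1)}

end NiemytzkiPlane

/-- `F` is an almost disjoint family of infinite subsets of `ℕ`. -/
def IsAlmostDisjointFamily (F : Set (Set ℕ)) : Prop :=
  (∀ A ∈ F, A.Infinite) ∧ ∀ A ∈ F, ∀ B ∈ F, A ≠ B → (A ∩ B).Finite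

/-- The points of the space `Ψ(F)`: the natural numbers and the members of `F`. -/
inductive PsiSpace (F : Set (Set ℕ)) : Type
  | nat (n : ℕ) : PsiSpace F
  | mem (A : F) : PsiSpace F

/-- The topology of `Ψ(F)`: natural numbers are isolated; the basic neighbourhoods of `A ∈ F` are
the sets `{A} ∪ (A \ K)` with `K` finite. -/
instance (F : Set (Set ℕ)) : TopologicalSpace (PsiSpace F) where
  IsOpen U := ∀ A : F, PsiSpace.mem A ∈ U → {n ∈ A.1 | PsiSpace.nat n ∉ U}.Finite
  isOpen_univ := by
    intro A _
    simp
  isOpen_inter := by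
    intro U V hU hV A hA
    refine ((hU A hA.1).union (hV A hA.2)).subset ?_
    rintro n ⟨hn, hnot⟩
    by_cases h : PsiSpace.nat n ∈ U
    · exact Or.inr ⟨hn, fun h' => hnot ⟨h, h'⟩⟩
    · exact Or.inl ⟨hn, h⟩
  isOpen_sUnion := by
    intro S hS A hA
    obtain ⟨U, hU, hAU⟩ := hA
    refine (hS U hU A hAU).subset ?_
    rintro n ⟨hn, hnot⟩
    exact ⟨hn, fun h => hnot ⟨U, hU, h⟩⟩

/-! The engine is diagonalization over a countable set of finite approximations: if any finitely
many of fewer than 𝔭 requirements can be met together, some sequence eventually meets each one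
(`exists_seq_eventually_mem`). Fewer than 𝔭 functions are dominated by a single one, so the same
holds for requirements linking consecutive terms (`exists_seq_eventually_step`).

The (a)-property is `isASpace_of_subcover`. Fewer than 𝔭 open sets N, each with closure inside a
cover member O N, cover the space. Finite subsets of a countable dense set grow until their star
contains O N; from then on no new point enters N. Their union is locally finite, hence closed
discrete. Both spaces consist of a closed discrete set of size ℵ₁ and a Lindelöf set; this yields
the small subcovers and the extent. Separability makes the web countable.

Normality rests on `exists_seq_eventually_mem_iff`. For branches of the binary tree it separates
each subfamily from its complement; for X ⊆ ℝ it makes every subset of X a relative F_σ, so the axis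
part of a closed set splits into countably many pieces that tangent discs separate from a disjoint
closed set (`NiemytzkiPlane.hasSeparatingCover`). -/

open Filter Topology

/-! ### Diagonalization below 𝔭 -/

/-- Fewer than `𝔭` subsets of a countable set, any finitely many of which have a common element,
admit a sequence which is eventually in each of them. -/
theorem exists_seq_eventually_mem {I C : Type} [Countable C] (hI : #I < pseudoIntersectionNumber)
    (F : I → Set C) (h : ∀ G : Finset I, ∃ c, ∀ i ∈ G, c ∈ F i) :
    ∃ u : ℕ → C, ∀ i, ∀ᶠ k in atTop, u k ∈ F i := by
  obtain ⟨c₀, -⟩ := h ∅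
  have : Nonempty C := ⟨c₀⟩
  -- The factor ℕ repeats each element infinitely often, so nonempty finite intersections become
  -- infinite ones.
  obtain ⟨e⟩ : Nonempty (C × ℕ ≃ ℕ) := by
    have := Encodable.ofCountable C
    have := Denumerable.ofEncodableOfInfinite (C × ℕ)
    exact ⟨Denumerable.eqv _⟩
  let B : I → Set ℕ := fun i => {n | (e.symm n).1 ∈ F i}
  have hlt : #(Set.range B) < pseudoIntersectionNumber := Cardinal.mk_range_le.trans_lt hI
  have hfin : ∀ G : Set (Set ℕ), G ⊆ Set.range B → G.Finite → (⋂₀ G).Infinite := by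
    intro G hG hGf
    obtain ⟨J, hJ⟩ : ∃ J : Finset I, G ⊆ B '' J := by
      have := hGf.to_subtype
      choose j hj using fun b : G => hG b.2
      exact ⟨(Set.finite_range j).toFinset, fun b hb => ⟨j ⟨b, hb⟩, by simp, hj ⟨b, hb⟩⟩⟩
    obtain ⟨c, hc⟩ := h J
    refine Set.infinite_of_injective_forall_mem (f := fun n : ℕ => e (c, n)) ?_ ?_
    · intro a b hab
      simpa using hab
    · intro n b hb
      obtain ⟨i, hi, rfl⟩ := hJ hb
      simpa [B] using hc i hi
  obtain ⟨P, hP, hPB⟩ : ∃ P : Set ℕ, P.Infinite ∧ ∀ b ∈ Set.range B, (P \ b).Finite := by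
    by_contra hcon
    exact absurd hlt (not_lt.2 (csInf_le' ⟨Set.range B, rfl, hfin, hcon⟩))
  let v : ℕ ↪ P := hP.natEmbedding
  refine ⟨fun k => (e.symm (v k)).1, fun i => ?_⟩
  have hfi : {k | (e.symm (v k)).1 ∉ F i}.Finite := by
    refine Set.Finite.of_finite_image (f := fun k => (v k : ℕ))
      ((hPB _ ⟨i, rfl⟩).subset ?_) ?_
    · rintro _ ⟨k, hk, rfl⟩
      exact ⟨(v k).2, hk⟩
    · intro a _ b _ hab
      exact v.injective (Subtype.ext hab)
  have := hfi.compl_mem_cofinite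
  rw [Nat.cofinite_eq_atTop] at this
  filter_upwards [this] with k hk
  simpa using hk

/-- Fewer than `𝔭` functions on a countable set are eventually dominated by a single one. -/
theorem exists_eventually_le {I D : Type} [Countable D] (h0 : ℵ₀ < pseudoIntersectionNumber)
    (hI : #I < pseudoIntersectionNumber) (g : I → D → ℕ) :
    ∃ h : D → ℕ, ∀ i, ∀ᶠ d in cofinite, g i d ≤ h d := by
  classical
  have hID : #(I ⊕ D) < pseudoIntersectionNumber := by
    rw [Cardinal.mk_sum, Cardinal.lift_id, Cardinal.lift_id]
    exact Cardinal.add_lt_of_lt h0.le hI ((Cardinal.mk_le_aleph0 (α := D)).trans_lt h0)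
  let F : I ⊕ D → Set (Finset D × ℕ) :=
    Sum.elim (fun i => {c | ∀ d ∈ c.1, g i d ≤ c.2}) (fun d => {c | d ∈ c.1})
  obtain ⟨u, hu⟩ := exists_seq_eventually_mem hID F (by
    intro G
    let a : Finset D := G.toRight
    refine ⟨(a, ∑ i ∈ G.toLeft, ∑ d ∈ a, g i d), ?_⟩
    rintro (i | d) hG
    · intro d hd
      exact (Finset.single_le_sum (f := fun d => g i d) (fun _ _ => Nat.zero_le _) hd).trans
        (Finset.single_le_sum (f := fun i => ∑ d ∈ a, g i d) (fun _ _ => Nat.zero_le _)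
          (Finset.mem_toLeft.2 hG))
    · exact Finset.mem_toRight.2 hG)
  obtain ⟨e, he⟩ := exists_injective_nat D
  -- Requiring `e d ≤ k` pushes all but finitely many `d` past the stage from which the bound for a
  -- given `i` is valid.
  have hk : ∀ d, ∃ k, e d ≤ k ∧ d ∈ (u k).1 := fun d =>
    ((eventually_ge_atTop (e d)).and (hu (Sum.inr d))).exists
  choose k hke hkd using hk
  refine ⟨fun d => (u (k d)).2, fun i => ?_⟩
  obtain ⟨K, hK⟩ := eventually_atTop.1 (hu (Sum.inl i))
  have : ∀ᶠ d in cofinite, K ≤ e d := by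
    have := he.tendsto_cofinite
    rw [Nat.cofinite_eq_atTop] at this
    exact this.eventually_ge_atTop K
  filter_upwards [this] with d hd
  exact hK (k d) (hd.trans (hke d)) d (hkd d)

/-- Fewer than `𝔭` requirements on consecutive terms of a sequence, any finitely many of which can
be met at each step, can all be met at almost all steps. -/
theorem exists_seq_eventually_step {I C : Type} [Countable C]
    (h0 : ℵ₀ < pseudoIntersectionNumber) (hI : #I < pseudoIntersectionNumber)
    (E : C → I → Set C) (h : ∀ s, ∀ G : Finset I, ∃ c, ∀ i ∈ G, c ∈ E s i) (s₀ : C) :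
    ∃ u : ℕ → C, ∀ i, ∀ᶠ k in atTop, u (k + 1) ∈ E (u k) i := by
  choose v hv using fun s => exists_seq_eventually_mem hI (E s) (h s)
  choose g hg using fun s i => eventually_atTop.1 (hv s i)
  -- The factor ℕ is a clock: a state may recur, but the pairs `(u k, k)` are distinct, so
  -- domination at almost all pairs gives domination at almost all steps.
  obtain ⟨b, hb⟩ := exists_eventually_le (D := C × ℕ) h0 hI (fun i d => g d.1 i)
  let u : ℕ → C := fun k => Nat.rec s₀ (fun k s => v s (b (s, k))) k
  refine ⟨u, fun i => ?_⟩
  have hinj : Function.Injective fun k => (u k, k) := fun a b hab => congrArg Prod.snd hab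
  have := hinj.tendsto_cofinite.eventually (hb i)
  rw [Nat.cofinite_eq_atTop] at this
  filter_upwards [this] with k hk
  exact hg (u k) i _ hk

/-! ### Stars, (a)-spaces and extent -/

theorem isClosed_isDiscrete_of_locally_finite {S : Type*} [TopologicalSpace S] [T1Space S]
    {P : Set S} (h : ∀ x, ∃ N ∈ 𝓝 x, (P ∩ N).Finite) : IsClosed P ∧ IsDiscrete P := by
  rw [isClosed_and_discrete_iff]
  intro x
  obtain ⟨N, hN, hf⟩ := h x
  rw [Filter.disjoint_principal_right, mem_nhdsWithin_iff_exists_mem_nhds_inter]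
  refine ⟨N ∩ ((P ∩ N) \ {x})ᶜ, inter_mem hN ?_, ?_⟩
  · exact (hf.subset Set.sdiff_subset).isClosed.isOpen_compl.mem_nhds (by simp)
  · rintro y ⟨⟨hyN, hy⟩, hyx⟩ hyP
    exact hy ⟨⟨hyP, hyN⟩, hyx⟩

theorem starOf_mono {S : Type*} [TopologicalSpace S] {A B : Set S} (h : A ⊆ B)
    (U : Set (Set S)) : starOf A U ⊆ starOf B U := by
  rintro x ⟨O, ⟨hO, hne⟩, hx⟩
  exact ⟨O, ⟨hO, hne.mono (Set.inter_subset_inter_right _ h)⟩, hx⟩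

theorem subset_starOf {S : Type*} [TopologicalSpace S] {A : Set S} {U : Set (Set S)}
    {O : Set S} (hO : O ∈ U) (h : (O ∩ A).Nonempty) : O ⊆ starOf A U :=
  fun _ hx => ⟨O, ⟨hO, h⟩, hx⟩

/-- A regular `T₁` space in which every dense set contains a countable dense set and every open
cover has a subcover with fewer than `𝔭` members is an (a)-space. -/
theorem isASpace_of_subcover {S : Type} [TopologicalSpace S] [T3Space S]
    (h0 : ℵ₀ < pseudoIntersectionNumber)
    (hd : ∀ Y : Set S, Dense Y → ∃ Z ⊆ Y, Z.Countable ∧ Dense Z)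
    (hL : ∀ U : Set (Set S), IsOpenCovering U →
      ∃ V ⊆ U, #V < pseudoIntersectionNumber ∧ ⋃₀ V = Set.univ) : IsASpace S := by
  classical
  intro U hU Y hY
  rcases isEmpty_or_nonempty S with hS | hS
  · exact ⟨∅, Set.empty_subset _, isClosed_empty, Set.subsingleton_empty.isDiscrete,
      Set.eq_univ_of_forall fun x => hS.elim x⟩
  obtain ⟨Z, hZY, hZc, hZd⟩ := hd Y hY
  have hZne : Nonempty Z := hZd.nonempty.to_subtype
  obtain ⟨V, hV, hVp, hVu⟩ := hL {N | IsOpen N ∧ ∃ O ∈ U, closure N ⊆ O} (by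
    refine ⟨fun N hN => hN.1, Set.eq_univ_of_forall fun x => ?_⟩
    obtain ⟨O, hO, hx⟩ : x ∈ ⋃₀ U := hU.2 ▸ Set.mem_univ x
    obtain ⟨N, hN, hNc, hNO⟩ := exists_mem_nhds_isClosed_subset ((hU.1 O hO).mem_nhds hx)
    exact ⟨interior N, ⟨isOpen_interior, O, hO,
      (hNc.closure_subset_iff.2 interior_subset).trans hNO⟩, mem_interior_iff_mem_nhds.2 hN⟩)
  have hVO : ∀ N : V, ∃ O ∈ U, closure N.1 ⊆ O := fun N => (hV N.2).2
  choose O hOU hNO using hVO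
  have := hZc.to_subtype
  let st : Finset Z → Set S := fun t => starOf ((↑) '' (t : Set Z)) U
  -- The first clause makes the sequence increase, the second forces the star to contain `O N`, the
  -- third freezes the trace on `N` afterwards.
  let E : Finset Z → V → Set (Finset Z) := fun t N =>
    {t' | t ⊆ t' ∧ O N ⊆ st t' ∧ (O N ⊆ st t → ∀ z ∈ t', z ∉ t → (z : S) ∉ N.1)}
  have hE : ∀ t, ∀ G : Finset V, ∃ t', ∀ N ∈ G, t' ∈ E t N := by
    intro t G
    -- A point of `O N` outside the star of `t` lies in no `closure M` with `O M ⊆ st t`. Removing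
    -- these finitely many closures leaves a nonempty open set, which meets `Z`.
    have key : ∀ N : V, ¬ O N ⊆ st t →
        ∃ z : Z, (z : S) ∈ O N ∧ ∀ M ∈ G, O M ⊆ st t → (z : S) ∉ M.1 := by
      intro N hN
      obtain ⟨x, hxN, hxt⟩ := Set.not_subset.1 hN
      have hopen : IsOpen (O N ∩ ⋂ M ∈ G.filter (fun M => O M ⊆ st t), (closure M.1)ᶜ) :=
        (hU.1 _ (hOU N)).inter (isOpen_biInter_finset fun M _ => isClosed_closure.isOpen_compl)
      obtain ⟨z, hz, hzZ⟩ := hZd.inter_open_nonempty _ hopen ⟨x, hxN, by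
        simp only [Set.mem_iInter]
        intro M hM hx
        exact hxt ((Finset.mem_filter.1 hM).2 (hNO M hx))⟩
      refine ⟨⟨z, hzZ⟩, hz.1, fun M hM hMt hzM => ?_⟩
      have := Set.mem_iInter₂.1 hz.2 M (Finset.mem_filter.2 ⟨hM, hMt⟩)
      exact this (subset_closure hzM)
    choose! z hz hzG using key
    refine ⟨t ∪ (G.filter fun N => ¬ O N ⊆ st t).image z, fun N hN => ⟨Finset.subset_union_left,
      ?_, ?_⟩⟩
    · by_cases hNt : O N ⊆ st t
      · exact hNt.trans (starOf_mono (Set.image_mono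
          (Finset.coe_subset.2 Finset.subset_union_left)) U)
      · refine subset_starOf (hOU N) ⟨z N, hz N hNt, ⟨z N, ?_, rfl⟩⟩
        exact Finset.mem_coe.2 (Finset.mem_union_right _
          (Finset.mem_image_of_mem _ (Finset.mem_filter.2 ⟨hN, hNt⟩)))
    · intro hNt y hy hyt
      rcases Finset.mem_union.1 hy with hy | hy
      · exact absurd hy hyt
      · obtain ⟨M, hM, rfl⟩ := Finset.mem_image.1 hy
        exact hzG M (Finset.mem_filter.1 hM).2 N hN hNt
  obtain ⟨u, hu⟩ := exists_seq_eventually_step h0 hVp E hE ∅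
  obtain ⟨N₀⟩ : Nonempty V := by
    obtain ⟨N, hN, -⟩ : hS.some ∈ ⋃₀ V := hVu ▸ Set.mem_univ _
    exact ⟨⟨N, hN⟩⟩
  -- Inclusion of consecutive terms does not depend on `N`, so a single `N₀` makes the sequence
  -- increasing from `K` on.
  obtain ⟨K, hK⟩ := eventually_atTop.1 (hu N₀)
  have hmono : ∀ k ≥ K, ∀ m ≥ k, u k ⊆ u m := by
    intro k hk m hm
    induction m, hm using Nat.le_induction with
    | base => exact subset_rfl
    | succ m hm ih => exact ih.trans (hK m (hk.trans hm)).1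
  let P : Set S := ⋃ k ≥ K, (↑) '' (u k : Set Z)
  have hPst : ∀ N : V, O N ⊆ starOf P U := by
    intro N
    obtain ⟨k, hk, hkK⟩ := ((hu N).and (eventually_ge_atTop K)).exists
    refine hk.2.1.trans (starOf_mono ?_ U)
    exact fun x hx => Set.mem_iUnion₂.2 ⟨k + 1, by omega, hx⟩
  have hPN : ∀ N : V, (P ∩ N.1).Finite := by
    intro N
    obtain ⟨k, hk⟩ := eventually_atTop.1 ((hu N).and (eventually_ge_atTop K))
    have hk0 := (hk k le_rfl).2
    refine ((u (k + 1)).finite_toSet.image ((↑) : Z → S)).subset ?_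
    have hstep : ∀ m ≥ k + 1, ∀ z ∈ u m, (z : S) ∈ N.1 → z ∈ u (k + 1) := by
      intro m hm
      induction m, hm using Nat.le_induction with
      | base => exact fun z hz _ => hz
      | succ m hm ih =>
        intro z hz hzN
        by_contra hcon
        by_cases hzm : z ∈ u m
        · exact hcon (ih z hzm hzN)
        -- The preceding step put `O N` into the star of `u m`, which activates the ban on new
        -- points in `N`.
        · obtain ⟨n, rfl⟩ : ∃ n, m = n + 1 := ⟨m - 1, by omega⟩
          exact (hk (n + 1) (by omega)).1.2.2 (hk n (by omega)).1.2.1 z hz hzm hzN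
    rintro x ⟨hx, hxN⟩
    obtain ⟨m, hm, z, hz, rfl⟩ := Set.mem_iUnion₂.1 hx
    refine ⟨z, ?_, rfl⟩
    rcases le_total (k + 1) m with hkm | hkm
    · exact hstep m hkm z hz hxN
    · exact hmono m hm _ hkm hz
  have hcd := isClosed_isDiscrete_of_locally_finite (P := P) (fun x => by
    obtain ⟨N, hN, hx⟩ : x ∈ ⋃₀ V := hVu ▸ Set.mem_univ x
    exact ⟨N, (hV hN).1.mem_nhds hx, hPN ⟨N, hN⟩⟩)
  refine ⟨P, ?_, hcd.1, hcd.2, Set.eq_univ_of_forall fun x => ?_⟩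
  · refine Set.iUnion₂_subset fun k _ => ?_
    rintro _ ⟨z, -, rfl⟩
    exact hZY z.2
  · obtain ⟨N, hN, hx⟩ : x ∈ ⋃₀ V := hVu ▸ Set.mem_univ x
    exact hPst ⟨N, hN⟩ (hNO ⟨N, hN⟩ (subset_closure hx))

/-- A separable (a)-space is in countable discrete web. -/
theorem IsASpace.inCountableDiscreteWeb {S : Type*} [TopologicalSpace S]
    [TopologicalSpace.SeparableSpace S] (h : IsASpace S) : InCountableDiscreteWeb S := by
  intro U hU
  obtain ⟨Y, hYc, hYd⟩ := TopologicalSpace.exists_countable_dense S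
  obtain ⟨A, hAY, hA⟩ := h U hU Y hYd
  exact ⟨A, hYc.mono hAY, hA⟩

/-- If a space is the union of a set with fewer than `𝔭` points and of a Lindelöf set, then every
open cover has a subcover with fewer than `𝔭` members. -/
theorem exists_subcover_of_isLindelof {S : Type} [TopologicalSpace S]
    (h0 : ℵ₀ < pseudoIntersectionNumber) {A B : Set S} (hA : #A < pseudoIntersectionNumber)
    (hB : IsLindelof B) (hAB : ∀ x, x ∈ A ∨ x ∈ B) {U : Set (Set S)} (hU : IsOpenCovering U) :
    ∃ V ⊆ U, #V < pseudoIntersectionNumber ∧ ⋃₀ V = Set.univ := by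
  have hx : ∀ x : S, ∃ O ∈ U, x ∈ O := fun x => by
    have : x ∈ ⋃₀ U := hU.2 ▸ Set.mem_univ x
    exact this
  choose O hOU hxO using hx
  obtain ⟨t, htc, -, hBt⟩ := hB.elim_nhds_subcover O
    (fun x _ => (hU.1 _ (hOU x)).mem_nhds (hxO x))
  refine ⟨O '' (A ∪ t), ?_, ?_, Set.eq_univ_of_forall fun x => ?_⟩
  · rintro _ ⟨x, -, rfl⟩
    exact hOU x
  · refine Cardinal.mk_image_le.trans_lt ((Cardinal.mk_union_le _ _).trans_lt ?_)
    exact Cardinal.add_lt_of_lt h0.le hA (htc.le_aleph0.trans_lt h0)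
  · rcases hAB x with hxA | hxB
    · exact ⟨O x, ⟨x, Or.inl hxA, rfl⟩, hxO x⟩
    · obtain ⟨y, hy, hxy⟩ := Set.mem_iUnion₂.1 (hBt hxB)
      exact ⟨O y, ⟨y, Or.inr hy, rfl⟩, hxy⟩

/-- The extent is `κ` if all closed discrete sets have at most `κ` points and some has `κ`. -/
theorem extent_eq_of_le {S : Type} [TopologicalSpace S] {κ : Cardinal.{0}} (hκ : ℵ₀ ≤ κ)
    (hle : ∀ D : Set S, IsClosed D → IsDiscrete D → #D ≤ κ)
    (D : Set S) (hD : IsClosed D) (hD' : IsDiscrete D) (hDκ : κ ≤ #D) : extent S = κ := by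
  refine le_antisymm (max_le hκ (ciSup_le' fun D => hle D.1 D.2.1 D.2.2)) ?_
  exact hDκ.trans ((le_ciSup (f := fun D : {D : Set S // IsClosed D ∧ IsDiscrete D} => #D.1)
    Cardinal.bddAbove_of_small ⟨D, hD, hD'⟩).trans (le_max_right _ _))

/-! ### Sorting points, and the spaces Ψ(F) -/

/-- Fewer than `𝔭` points can be sorted by a sequence of members of a countable family of sets
which is able to sort finitely many points. -/
theorem exists_seq_eventually_mem_iff {T C : Type} [Countable C] (W : C → Set T)
    (hW : ∀ G H : Finset T, Disjoint G H → ∃ c, (∀ x ∈ G, x ∈ W c) ∧ ∀ x ∈ H, x ∉ W c)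
    {X : Set T} (hX : #X < pseudoIntersectionNumber) (Y : Set T) :
    ∃ u : ℕ → C, ∀ x ∈ X, ∀ᶠ k in atTop, (x ∈ W (u k) ↔ x ∈ Y) := by
  classical
  obtain ⟨u, hu⟩ := exists_seq_eventually_mem hX (fun x => {c | x.1 ∈ W c ↔ x.1 ∈ Y}) (by
    intro G
    let G' : Finset T := G.image (↑)
    obtain ⟨c, hc, hc'⟩ := hW (G'.filter (· ∈ Y)) (G'.filter (· ∉ Y))
      (Finset.disjoint_filter_filter_not _ _ _)
    refine ⟨c, fun i hi => ?_⟩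
    have hi' : i.1 ∈ G' := Finset.mem_image_of_mem _ hi
    by_cases hiY : i.1 ∈ Y
    · exact iff_of_true (hc _ (Finset.mem_filter.2 ⟨hi', hiY⟩)) hiY
    · exact iff_of_false (hc' _ (Finset.mem_filter.2 ⟨hi', hiY⟩)) hiY)
  exact ⟨u, fun x hx => hu ⟨x, hx⟩⟩

namespace PsiSpace

variable {F : Set (Set ℕ)}

theorem isOpen_iff {U : Set (PsiSpace F)} :
    IsOpen U ↔ ∀ A : F, mem A ∈ U → {n ∈ A.1 | nat n ∉ U}.Finite := Iff.rfl

theorem isClosed_iff {U : Set (PsiSpace F)} :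
    IsClosed U ↔ ∀ A : F, mem A ∉ U → {n ∈ A.1 | nat n ∈ U}.Finite := by
  simp [← isOpen_compl_iff, isOpen_iff]

theorem isOpen_singleton_nat (n : ℕ) : IsOpen ({nat n} : Set (PsiSpace F)) :=
  isOpen_iff.2 fun A hA => by simp at hA

instance : T1Space (PsiSpace F) where
  t1 x := isClosed_iff.2 fun A _ => Set.Subsingleton.finite fun a ha b hb => by
    simpa using ha.2.trans hb.2.symm

/-- Almost disjointness makes the basic neighbourhoods of A clopen: any other member meets A in a
finite set. -/
theorem t3Space (hF : IsAlmostDisjointFamily F) : T3Space (PsiSpace F) := by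
  have : RegularSpace (PsiSpace F) := by
    refine RegularSpace.of_exists_mem_nhds_isClosed_subset fun x s hs => ?_
    obtain ⟨U, hUs, hU, hx⟩ := mem_nhds_iff.1 hs
    cases x with
    | nat n =>
      exact ⟨{nat n}, (isOpen_singleton_nat n).mem_nhds rfl, isClosed_singleton,
        Set.singleton_subset_iff.2 (hUs hx)⟩
    | mem A =>
      refine ⟨{mem A} ∪ nat '' {n ∈ A.1 | nat n ∈ U}, IsOpen.mem_nhds ?_ (Or.inl rfl), ?_, ?_⟩
      · refine isOpen_iff.2 fun B hB => ?_
        obtain rfl : B = A := by simpa using hB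
        refine (isOpen_iff.1 hU B hx).subset ?_
        rintro n ⟨hn, hn'⟩
        exact ⟨hn, fun h => hn' (Or.inr ⟨n, ⟨hn, h⟩, rfl⟩)⟩
      · refine isClosed_iff.2 fun B hB => ?_
        have hBA : B ≠ A := by rintro rfl; exact hB (Or.inl rfl)
        refine (hF.2 B B.2 A A.2 (fun h => hBA (Subtype.ext h))).subset ?_
        rintro n ⟨hn, hn'⟩
        simp only [Set.singleton_union, Set.mem_insert_iff, reduceCtorEq, Set.mem_image,
          nat.injEq, exists_eq_right, false_or] at hn'
        exact ⟨hn, hn'.1⟩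
      · rintro _ (rfl | ⟨n, hn, rfl⟩)
        exacts [hUs hx, hUs hn.2]
  infer_instance

theorem dense_range_nat (hF : IsAlmostDisjointFamily F) :
    Dense (Set.range (nat : ℕ → PsiSpace F)) := by
  refine dense_iff_inter_open.2 fun U hU ⟨x, hx⟩ => ?_
  cases x with
  | nat n => exact ⟨nat n, hx, n, rfl⟩
  | mem A =>
    obtain ⟨n, hnA, hn⟩ := (hF.1 A A.2).exists_notMem_finite (isOpen_iff.1 hU A hx)
    exact ⟨nat n, by_contra fun h => hn ⟨hnA, h⟩, n, rfl⟩

theorem range_nat_subset {Y : Set (PsiSpace F)} (hY : Dense Y) : Set.range nat ⊆ Y := by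
  rintro _ ⟨n, rfl⟩
  obtain ⟨y, rfl, hy⟩ := hY.inter_open_nonempty _ (isOpen_singleton_nat n) ⟨_, rfl⟩
  exact hy

theorem separableSpace (hF : IsAlmostDisjointFamily F) :
    TopologicalSpace.SeparableSpace (PsiSpace F) :=
  ⟨_, Set.countable_range _, dense_range_nat hF⟩

theorem mk_range_mem : #(Set.range (mem : F → PsiSpace F)) = #F :=
  Cardinal.mk_range_eq _ fun _ _ h => mem.inj h

theorem range_nat_union_range_mem (x : PsiSpace F) :
    x ∈ Set.range (mem : F → PsiSpace F) ∨ x ∈ Set.range (nat : ℕ → PsiSpace F) := by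
  cases x with
  | nat n => exact Or.inr ⟨n, rfl⟩
  | mem A => exact Or.inl ⟨A, rfl⟩

theorem isASpace (h0 : ℵ₀ < pseudoIntersectionNumber) (hF : IsAlmostDisjointFamily F)
    (hFp : #F < pseudoIntersectionNumber) : IsASpace (PsiSpace F) := by
  have := t3Space hF
  refine isASpace_of_subcover h0 (fun Y hY => ⟨_, range_nat_subset hY, Set.countable_range _,
    dense_range_nat hF⟩) fun U hU => ?_
  exact exists_subcover_of_isLindelof h0 (mk_range_mem.trans_lt hFp)
    (Set.countable_range nat).isLindelof range_nat_union_range_mem hU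

theorem extent_eq (hF : ℵ₀ ≤ #F) : extent (PsiSpace F) = #F := by
  have hcd := isClosed_isDiscrete_of_locally_finite (P := Set.range (mem : F → PsiSpace F))
    fun x => by
      cases x with
      | nat n =>
        refine ⟨_, (isOpen_singleton_nat n).mem_nhds rfl, Set.Finite.subset (Set.finite_empty) ?_⟩
        rintro _ ⟨⟨A, rfl⟩, h⟩
        simp at h
      | mem A =>
        refine ⟨{mem A} ∪ Set.range nat, IsOpen.mem_nhds (isOpen_iff.2 fun B _ => ?_)
          (Or.inl rfl), (Set.finite_singleton (mem A)).subset ?_⟩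
        · simp
        · rintro _ ⟨⟨B, rfl⟩, h⟩
          simpa using h
  refine extent_eq_of_le hF (fun D _ _ => ?_) _ hcd.1 hcd.2 mk_range_mem.ge
  have h1 : D ⊆ Set.range (mem : F → PsiSpace F) ∪ Set.range nat :=
    fun x _ => range_nat_union_range_mem x
  refine (Cardinal.mk_le_mk_of_subset h1).trans ((Cardinal.mk_union_le _ _).trans ?_)
  rw [mk_range_mem]
  exact (add_le_add_right (Set.countable_range _).le_aleph0 _).trans (Cardinal.add_eq_left hF hF).le

/-- `Ψ(F)` is normal if every subfamily of `F` can be separated from its complement. -/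
theorem normalSpace_of_separated
    (h : ∀ B : Set (Set ℕ), ∃ P : Set ℕ, ∀ A ∈ F, (A ∈ B → (A \ P).Finite) ∧
      (A ∉ B → (A ∩ P).Finite)) : NormalSpace (PsiSpace F) where
  normal H K hH hK hHK := by
    obtain ⟨P, hP⟩ := h {A | ∃ hA : A ∈ F, mem ⟨A, hA⟩ ∈ H}
    -- Closedness of `K` (resp. `H`) means that removing it costs only finitely many elements of a
    -- member lying outside it.
    refine ⟨H ∪ (nat '' P \ K), K ∪ (nat '' Pᶜ \ H), ?_, ?_, Set.subset_union_left,
      Set.subset_union_left, ?_⟩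
    · refine isOpen_iff.2 fun A hA => ?_
      have hAH : mem A ∈ H := by simpa using hA
      refine (((hP A A.2).1 ⟨A.2, hAH⟩).union
        (isClosed_iff.1 hK A (Set.disjoint_left.1 hHK hAH))).subset ?_
      rintro n ⟨hn, hn'⟩
      by_cases hnK : nat n ∈ K
      · exact Or.inr ⟨hn, hnK⟩
      · exact Or.inl ⟨hn, fun hnP => hn' (Or.inr ⟨⟨n, hnP, rfl⟩, hnK⟩)⟩
    · refine isOpen_iff.2 fun A hA => ?_
      have hAK : mem A ∈ K := by simpa using hA
      have hAH : mem A ∉ H := Set.disjoint_right.1 hHK hAK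
      refine (((hP A A.2).2 (fun ⟨_, h⟩ => hAH h)).union (isClosed_iff.1 hH A hAH)).subset ?_
      rintro n ⟨hn, hn'⟩
      by_cases hnH : nat n ∈ H
      · exact Or.inr ⟨hn, hnH⟩
      · exact Or.inl ⟨hn, by_contra fun hnP => hn' (Or.inr ⟨⟨n, hnP, rfl⟩, hnH⟩)⟩
    · rw [Set.disjoint_left]
      rintro x (hx | ⟨⟨n, hn, rfl⟩, hx⟩) (hx' | ⟨⟨m, hm, hmx⟩, hx'⟩)
      · exact Set.disjoint_left.1 hHK hx hx'
      · exact hx' hx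
      · exact hx hx'
      · exact hm ((nat.inj hmx) ▸ hn)

end PsiSpace

/-! ### Branches of the binary tree and a normal Ψ(F) -/

/-- The codes of the initial segments of a set of natural numbers. -/
def initialSegmentCodes (x : Set ℕ) : Set ℕ :=
  {c | ∃ (n : ℕ) (a : Finset ℕ), (a : Set ℕ) = x ∩ Set.Iio n ∧ c = Encodable.encode (n, a)}

theorem exists_finset_eq_inter_Iio (x : Set ℕ) (n : ℕ) :
    ∃ a : Finset ℕ, (a : Set ℕ) = x ∩ Set.Iio n :=
  ⟨((Set.finite_Iio n).inter_of_right x).toFinset, by simp⟩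

theorem infinite_initialSegmentCodes (x : Set ℕ) : (initialSegmentCodes x).Infinite := by
  choose a ha using exists_finset_eq_inter_Iio x
  refine Set.infinite_of_injective_forall_mem (f := fun n => Encodable.encode (n, a n)) ?_
    fun n => ⟨n, a n, ha n, rfl⟩
  intro n m h
  exact congrArg Prod.fst (Encodable.encode_injective h)

/-- Finitely many distinct sets of natural numbers have distinct long initial segments. -/
theorem exists_forall_inter_Iio_ne {x y : Set ℕ} (h : x ≠ y) :
    ∃ m, ∀ n ≥ m, x ∩ Set.Iio n ≠ y ∩ Set.Iio n := by
  obtain ⟨k, hk⟩ : ∃ k, ¬ (k ∈ x ↔ k ∈ y) := by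
    by_contra! hcon
    exact h (Set.ext hcon)
  refine ⟨k + 1, fun n hn heq => hk ?_⟩
  have := Set.ext_iff.1 heq k
  simpa [show k < n by omega] using this

/-- Only finitely many codes in `initialSegmentCodes x` are codes of segments below a bound. -/
theorem finite_of_forall_lt {x : Set ℕ} {Q : Set ℕ} {m : ℕ}
    (h : ∀ (n : ℕ) (a : Finset ℕ), (a : Set ℕ) = x ∩ Set.Iio n → Encodable.encode (n, a) ∈ Q → n < m) :
    (initialSegmentCodes x ∩ Q).Finite := by
  choose a ha using exists_finset_eq_inter_Iio x
  refine ((Set.finite_Iio m).image fun n => Encodable.encode (n, a n)).subset ?_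
  rintro _ ⟨⟨n, b, hb, rfl⟩, hQ⟩
  have : b = a n := Finset.coe_injective (hb.trans (ha n).symm)
  subst this
  exact ⟨n, h n _ hb hQ, rfl⟩

/-- A common code determines a level at which the two branches still agree, so it lies below their
splitting level. -/
theorem finite_initialSegmentCodes_inter {x y : Set ℕ} (h : x ≠ y) :
    (initialSegmentCodes x ∩ initialSegmentCodes y).Finite := by
  obtain ⟨m, hm⟩ := exists_forall_inter_Iio_ne h
  refine finite_of_forall_lt (m := m) ?_
  rintro n a ha ⟨n', a', ha', he⟩
  obtain ⟨rfl, rfl⟩ := Prod.mk.inj (Encodable.encode_injective he)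
  by_contra hn
  exact hm n (not_lt.1 hn) (ha.symm.trans ha')

theorem injective_initialSegmentCodes : Function.Injective initialSegmentCodes := by
  intro x y h
  by_contra hne
  have := finite_initialSegmentCodes_inter hne
  rw [h, Set.inter_self] at this
  exact infinite_initialSegmentCodes y this

theorem isAlmostDisjointFamily_image_initialSegmentCodes (X : Set (Set ℕ)) :
    IsAlmostDisjointFamily (initialSegmentCodes '' X) := by
  refine ⟨?_, ?_⟩
  · rintro _ ⟨x, -, rfl⟩
    exact infinite_initialSegmentCodes x
  · rintro _ ⟨x, -, rfl⟩ _ ⟨y, -, rfl⟩ hne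
    exact finite_initialSegmentCodes_inter fun h => hne (h ▸ rfl)

/-- A pair `c` codes a clopen set of the Cantor space: the branches through the nodes `c.2` at level
`c.1`. One high enough level tells finitely many branches apart. -/
theorem exists_forall_mem_inter_Iio_mem_iff (G H : Finset (Set ℕ)) (hGH : Disjoint G H) :
    ∃ c : ℕ × Finset (Finset ℕ), (∀ x ∈ G, ∃ a ∈ c.2, (a : Set ℕ) = x ∩ Set.Iio c.1) ∧
      ∀ x ∈ H, ¬ ∃ a ∈ c.2, (a : Set ℕ) = x ∩ Set.Iio c.1 := by
  classical
  have hm : ∀ x y : Set ℕ, ∃ m, x ≠ y → ∀ n ≥ m, x ∩ Set.Iio n ≠ y ∩ Set.Iio n := fun x y => by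
    by_cases h : x = y
    · exact ⟨0, fun h' => absurd h h'⟩
    · obtain ⟨m, hm⟩ := exists_forall_inter_Iio_ne h
      exact ⟨m, fun _ => hm⟩
  choose m hm using hm
  choose a ha using exists_finset_eq_inter_Iio
  let N := ∑ x ∈ G, ∑ y ∈ H, m x y
  refine ⟨(N, G.image fun x => a x N), fun x hx => ⟨a x N, Finset.mem_image_of_mem _ hx,
    ha x N⟩, ?_⟩
  rintro y hy ⟨b, hb, hby⟩
  obtain ⟨x, hx, rfl⟩ := Finset.mem_image.1 hb
  have hxy : x ≠ y := fun h => Finset.disjoint_left.1 hGH hx (h ▸ hy)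
  refine hm x y hxy N ?_ ((ha x N).symm.trans hby)
  exact (Finset.single_le_sum (f := fun y => m x y) (fun _ _ => Nat.zero_le _) hy).trans
    (Finset.single_le_sum (f := fun x => ∑ y ∈ H, m x y) (fun _ _ => Nat.zero_le _) hx)

/-- Fewer than `𝔭` branches of the binary tree form an almost disjoint family each of whose
subfamilies can be separated from its complement. -/
theorem exists_separating_initialSegmentCodes {X : Set (Set ℕ)}
    (hX : #X < pseudoIntersectionNumber) (B : Set (Set ℕ)) :
    ∃ P : Set ℕ, ∀ A ∈ initialSegmentCodes '' X, (A ∈ B → (A \ P).Finite) ∧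
      (A ∉ B → (A ∩ P).Finite) := by
  classical
  obtain ⟨u, hu⟩ := exists_seq_eventually_mem_iff
    (fun c : ℕ × Finset (Finset ℕ) => {x : Set ℕ | ∃ a ∈ c.2, (a : Set ℕ) = x ∩ Set.Iio c.1})
    exists_forall_mem_inter_Iio_mem_iff hX {x | initialSegmentCodes x ∈ B}
  -- A node of level `n` can be tested only by clopen sets of level at most `n`; `k n` is the last
  -- usable index up to `n`, and it tends to infinity. The default 0 is harmless, since only large
  -- `n` matter.
  let k : ℕ → ℕ := fun n => Nat.findGreatest (fun k => (u k).1 ≤ n) n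
  have hk : ∀ K, ∀ n ≥ max K (u K).1, K ≤ k n ∧ (u (k n)).1 ≤ n := fun K n hn =>
    ⟨Nat.le_findGreatest ((le_max_left _ _).trans hn) ((le_max_right _ _).trans hn),
      Nat.findGreatest_spec (P := fun k => (u k).1 ≤ n) ((le_max_left _ _).trans hn)
        ((le_max_right _ _).trans hn)⟩
  refine ⟨{c | ∃ (n : ℕ) (a : Finset ℕ), c = Encodable.encode (n, a) ∧
    ∃ b ∈ (u (k n)).2, (b : Set ℕ) = (a : Set ℕ) ∩ Set.Iio (u (k n)).1}, ?_⟩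
  rintro _ ⟨x, hx, rfl⟩
  obtain ⟨K, hK⟩ := eventually_atTop.1 (hu x hx)
  have key : ∀ n ≥ max K (u K).1, ∀ a : Finset ℕ, (a : Set ℕ) = x ∩ Set.Iio n →
      ((∃ b ∈ (u (k n)).2, (b : Set ℕ) = (a : Set ℕ) ∩ Set.Iio (u (k n)).1) ↔
        initialSegmentCodes x ∈ B) := by
    intro n hn a ha
    obtain ⟨h1, h2⟩ := hk K n hn
    rw [ha, Set.inter_assoc, Set.Iio_inter_Iio, min_eq_right h2]
    exact hK (k n) h1
  refine ⟨fun hB => ?_, fun hB => ?_⟩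
  · rw [Set.sdiff_eq]
    refine finite_of_forall_lt (m := max K (u K).1) fun n a ha hP => ?_
    by_contra hn
    exact hP ⟨n, a, rfl, (key n (not_lt.1 hn) a ha).2 hB⟩
  · refine finite_of_forall_lt (m := max K (u K).1) fun n a ha hP => ?_
    by_contra hn
    obtain ⟨n', a', he, hb⟩ := hP
    obtain ⟨rfl, rfl⟩ := Prod.mk.inj (Encodable.encode_injective he)
    exact hB ((key n (not_lt.1 hn) a ha).1 hb)

theorem exists_isAlmostDisjointFamily_t4Space (hp : ℵ₁ < pseudoIntersectionNumber) :
    ∃ F : Set (Set ℕ), IsAlmostDisjointFamily F ∧ #F = ℵ₁ ∧ T4Space (PsiSpace F) := by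
  obtain ⟨X, hX⟩ : ∃ X : Set (Set ℕ), #X = ℵ₁ := by
    refine Cardinal.le_mk_iff_exists_set.1 ?_
    rw [Cardinal.mk_set, Cardinal.mk_nat]
    exact Cardinal.aleph_one_le_continuum
  have hF := isAlmostDisjointFamily_image_initialSegmentCodes X
  have := PsiSpace.normalSpace_of_separated
    (exists_separating_initialSegmentCodes (hX.trans_lt hp))
  exact ⟨_, hF, (Cardinal.mk_image_eq injective_initialSegmentCodes).trans hX, {}⟩

/-! ### Relative F_σ sets and separating covers -/

/-- Every subset of a set of fewer than `𝔭` real numbers is a relative `F_σ` set. -/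
theorem exists_isClosed_forall_mem_iff {X : Set ℝ} (hX : #X < pseudoIntersectionNumber)
    (Y : Set ℝ) :
    ∃ F : ℕ → Set ℝ, (∀ k, IsClosed (F k)) ∧ ∀ x ∈ X, (x ∈ Y ↔ ∃ k, x ∈ F k) := by
  classical
  let W : Finset (ℚ × ℚ) → Set ℝ := fun c => ⋃ p ∈ c, Set.Icc (p.1 : ℝ) p.2
  obtain ⟨u, hu⟩ := exists_seq_eventually_mem_iff W (by
    intro G H hGH
    have hx : ∀ x : ℝ, ∃ p : ℚ × ℚ, x ∈ Set.Icc (p.1 : ℝ) p.2 ∧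
        (x ∉ H → ∀ y ∈ H, y ∉ Set.Icc (p.1 : ℝ) p.2) := by
      intro x
      have hopen : IsOpen ((H.erase x : Finset ℝ) : Set ℝ)ᶜ :=
        (Finset.finite_toSet _).isClosed.isOpen_compl
      obtain ⟨ε, hε, hb⟩ := Metric.isOpen_iff.1 hopen x (by simp)
      obtain ⟨a, ha, ha'⟩ := exists_rat_btwn (show x - ε < x by linarith)
      obtain ⟨b, hb1, hb2⟩ := exists_rat_btwn (show x < x + ε by linarith)
      refine ⟨(a, b), ⟨ha'.le, hb1.le⟩, fun hxH y hy hyI => ?_⟩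
      have hyx : y ≠ x := fun h => hxH (h ▸ hy)
      have : y ∈ Metric.ball x ε := by
        rw [Real.ball_eq_Ioo]
        exact ⟨ha.trans_le hyI.1, hyI.2.trans_lt hb2⟩
      exact hb this (by simp [hyx, hy])
    choose p hp hpH using hx
    refine ⟨G.image p, fun x hx => Set.mem_iUnion₂.2 ⟨p x, Finset.mem_image_of_mem _ hx, hp x⟩,
      fun y hy hyW => ?_⟩
    obtain ⟨q, hq, hyq⟩ := Set.mem_iUnion₂.1 hyW
    obtain ⟨x, hx, rfl⟩ := Finset.mem_image.1 hq
    exact hpH x (Finset.disjoint_left.1 hGH hx) y hy hyq) hX Y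
  -- On `X`, membership in `Y` is membership in almost all `W (u j)`, a countable union of
  -- intersections of closed sets.
  refine ⟨fun k => ⋂ j ≥ k, W (u j), fun k => isClosed_biInter fun j _ =>
    (Finset.finite_toSet _).isClosed_biUnion fun _ _ => isClosed_Icc, fun x hx => ?_⟩
  obtain ⟨K, hK⟩ := eventually_atTop.1 (hu x hx)
  refine ⟨fun hxY => ⟨K, Set.mem_iInter₂.2 fun j hj => (hK j hj).2 hxY⟩, ?_⟩
  rintro ⟨k, hk⟩
  exact (hK (max k K) (le_max_right _ _)).1 (Set.mem_iInter₂.1 hk _ (le_max_left k K))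

theorem hasSeparatingCover_of_countable {S : Type*} [TopologicalSpace S] {s t : Set S}
    {C : Set (Set S)} (hC : C.Countable) (hs : s ⊆ ⋃₀ C)
    (h : ∀ U ∈ C, IsOpen U ∧ Disjoint (closure U) t) : HasSeparatingCover s t := by
  -- Adding `∅` allows an enumeration even when `C` is empty.
  obtain ⟨u, hu⟩ := (hC.insert ∅).exists_eq_range (Set.insert_nonempty _ _)
  refine ⟨u, fun x hx => ?_, fun n => ?_⟩
  · obtain ⟨U, hU, hxU⟩ := hs hx
    obtain ⟨n, rfl⟩ : U ∈ Set.range u := hu ▸ Set.mem_insert_of_mem _ hU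
    exact Set.mem_iUnion.2 ⟨n, hxU⟩
  · have : u n ∈ insert ∅ C := hu ▸ Set.mem_range_self n
    rcases this with h0 | hn
    · rw [h0]
      simp
    · exact h _ hn

/-! ### The strip in the Moore–Niemytzki plane -/

namespace NiemytzkiPlane

theorem continuous_x : Continuous NiemytzkiPlane.x := by
  refine continuous_def.2 fun O hO p hp => ?_
  obtain ⟨ε, hε, hb⟩ := Metric.isOpen_iff.1 hO p.x hp
  refine ⟨fun _ => ⟨ε, hε, fun q hq => hb ?_⟩, fun _ => ⟨ε, hε, fun q hq => hb ?_⟩⟩ <;>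
  · have hq' : (q.x - p.x) ^ 2 + (q.y - _) ^ 2 < ε ^ 2 := hq
    rw [Metric.mem_ball, Real.dist_eq]
    exact abs_lt_of_sq_lt_sq (by nlinarith [sq_nonneg (q.y - p.y), sq_nonneg (q.y - ε)]) hε.le

theorem continuous_y : Continuous NiemytzkiPlane.y := by
  refine continuous_def.2 fun O hO p hp => ?_
  obtain ⟨ε, hε, hb⟩ := Metric.isOpen_iff.1 hO p.y hp
  -- A tangent disc of radius ε/2 reaches up to height ε.
  refine ⟨fun _ => ⟨ε, hε, fun q hq => hb ?_⟩, fun h0 => ⟨ε / 2, by positivity,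
    fun q hq => hb ?_⟩⟩
  · have hq' : (q.x - p.x) ^ 2 + (q.y - p.y) ^ 2 < ε ^ 2 := hq
    rw [Metric.mem_ball, Real.dist_eq]
    exact abs_lt_of_sq_lt_sq (by nlinarith [sq_nonneg (q.x - p.x)]) hε.le
  · have hq' : (q.x - p.x) ^ 2 + (q.y - ε / 2) ^ 2 < (ε / 2) ^ 2 := hq
    rw [Metric.mem_ball, Real.dist_eq, h0, sub_zero, abs_of_nonneg q.y_nonneg]
    nlinarith [sq_nonneg (q.x - p.x), q.y_nonneg]

theorem isOpen_disc (a b r : ℝ) : IsOpen (disc a b r) := by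
  have hx := continuous_x
  have hy := continuous_y
  exact isOpen_lt (by fun_prop) continuous_const

theorem isOpen_insert_disc {p : NiemytzkiPlane} (hp : p.y = 0) {r : ℝ} (hr : 0 < r) :
    IsOpen (insert p (disc p.x r r)) := by
  rintro q (rfl | hq)
  · exact ⟨fun h => absurd hp h.ne', fun _ => ⟨r, hr, Set.subset_insert _ _⟩⟩
  · obtain ⟨h1, h2⟩ := isOpen_disc p.x r r q hq
    refine ⟨fun h => ?_, fun h => ?_⟩
    · obtain ⟨s, hs, hsub⟩ := h1 h
      exact ⟨s, hs, hsub.trans (Set.subset_insert _ _)⟩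
    · obtain ⟨s, hs, hsub⟩ := h2 h
      exact ⟨s, hs, hsub.trans (Set.subset_insert _ _)⟩

variable {X : Set ℝ}

/-- The Euclidean coordinates of a point of the strip. -/
def coord (p : strip X) : ℝ × ℝ := (p.1.x, p.1.y)

/-- The part of the strip above the axis. -/
def upper (X : Set ℝ) : Set (strip X) := {p | 0 < p.1.y}

/-- The part of the strip on the axis. -/
def axis (X : Set ℝ) : Set (strip X) := {p | p.1.y = 0}

theorem mem_axis_or_mem_upper (p : strip X) : p ∈ axis X ∨ p ∈ upper X :=
  p.1.y_nonneg.eq_or_lt.imp_left Eq.symm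

theorem continuous_coord : Continuous (coord (X := X)) :=
  (continuous_x.comp continuous_subtype_val).prodMk (continuous_y.comp continuous_subtype_val)

theorem injective_coord : Function.Injective (coord (X := X)) := fun _ _ h =>
  Subtype.ext (NiemytzkiPlane.ext (congrArg Prod.fst h) (congrArg Prod.snd h))

instance : T2Space (strip X) := T2Space.of_injective_continuous injective_coord continuous_coord

theorem isOpen_upper : IsOpen (upper X) :=
  isOpen_lt continuous_const (continuous_y.comp continuous_subtype_val)

theorem isClosed_axis : IsClosed (axis X) :=
  isClosed_eq (continuous_y.comp continuous_subtype_val) continuous_const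

/-- Above the axis the topology is Euclidean, so every subset there is second countable and
Lindelöf. -/
theorem nhds_eq_comap_coord {p : strip X} (hp : p ∈ upper X) :
    𝓝 p = comap coord (𝓝 (coord p)) := by
  refine le_antisymm continuous_coord.continuousAt.le_comap fun s hs => ?_
  obtain ⟨u, hu, hus⟩ := (mem_nhds_subtype _ _ _).1 hs
  obtain ⟨V, hVu, hV, hpV⟩ := mem_nhds_iff.1 hu
  obtain ⟨r, hr, hrV⟩ := (hV p.1 hpV).1 hp
  let O : Set (ℝ × ℝ) := {z | (z.1 - p.1.x) ^ 2 + (z.2 - p.1.y) ^ 2 < r ^ 2}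
  have hO : IsOpen O := isOpen_lt (by fun_prop) continuous_const
  have hpO : coord p ∈ O := by simpa [O, coord] using pow_pos hr 2
  exact ⟨O, hO.mem_nhds hpO, fun q hq => hus (hVu (hrV hq))⟩

theorem exists_disc_subset_of_mem_nhds {p : strip X} (hp : p ∈ axis X) {s : Set (strip X)}
    (hs : s ∈ 𝓝 p) : ∃ r > 0, ∀ q : strip X, q.1 ∈ disc p.1.x r r → q ∈ s := by
  obtain ⟨u, hu, hus⟩ := (mem_nhds_subtype _ _ _).1 hs
  obtain ⟨V, hVu, hV, hpV⟩ := mem_nhds_iff.1 hu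
  obtain ⟨r, hr, hrV⟩ := (hV p.1 hpV).2 hp
  exact ⟨r, hr, fun q hq => hus (hVu (hrV hq))⟩

/-- The basic neighbourhood of a point of the axis. -/
def tangentNhd (p : strip X) (r : ℝ) : Set (strip X) := (↑) ⁻¹' insert p.1 (disc p.1.x r r)

theorem mem_tangentNhd {p q : strip X} {r : ℝ} :
    q ∈ tangentNhd p r ↔ q = p ∨ (q.1.x - p.1.x) ^ 2 + (q.1.y - r) ^ 2 < r ^ 2 :=
  or_congr Subtype.ext_iff.symm Iff.rfl

theorem isOpen_tangentNhd {p : strip X} (hp : p ∈ axis X) {r : ℝ} (hr : 0 < r) :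
    IsOpen (tangentNhd p r) :=
  (isOpen_insert_disc hp hr).preimage continuous_subtype_val

theorem self_mem_tangentNhd (p : strip X) (r : ℝ) : p ∈ tangentNhd p r :=
  mem_tangentNhd.2 (Or.inl rfl)

theorem dense_upper : Dense (upper X) := by
  refine dense_iff_inter_open.2 fun U hU ⟨p, hpU⟩ => ?_
  rcases mem_axis_or_mem_upper p with hp | hp
  · obtain ⟨r, hr, h⟩ := exists_disc_subset_of_mem_nhds hp (hU.mem_nhds hpU)
    have ht : 0 < min r (1 / 2) := lt_min hr (by norm_num)
    have ht' : min r (1 / 2) < 1 := (min_le_right _ _).trans_lt (by norm_num)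
    refine ⟨⟨⟨p.1.x, min r (1 / 2), ht.le⟩, Or.inr ⟨ht, ht'⟩⟩, h _ ?_, ht⟩
    show (p.1.x - p.1.x) ^ 2 + (min r (1 / 2) - r) ^ 2 < r ^ 2
    nlinarith [min_le_left r (1 / 2)]
  · exact ⟨p, hpU, hp⟩

theorem secondCountableTopology_of_subset_upper {T : Set (strip X)} (hT : T ⊆ upper X) :
    SecondCountableTopology T := by
  have : IsInducing fun p : T => coord p.1 := isInducing_iff_nhds.2 fun p => by
    rw [nhds_subtype, nhds_eq_comap_coord (hT p.2), comap_comap]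
    rfl
  exact this.secondCountableTopology

theorem isLindelof_of_subset_upper {T : Set (strip X)} (hT : T ⊆ upper X) : IsLindelof T := by
  have := secondCountableTopology_of_subset_upper hT
  exact isLindelof_iff_lindelofSpace.2 inferInstance

theorem exists_countable_dense_subset {Y : Set (strip X)} (hY : Dense Y) :
    ∃ Z ⊆ Y, Z.Countable ∧ Dense Z := by
  have := secondCountableTopology_of_subset_upper (T := Y ∩ upper X) Set.inter_subset_right
  obtain ⟨Z, hZ, h⟩ :=
    (hY.inter_of_isOpen_right dense_upper isOpen_upper).exists_countable_dense_subset
  exact ⟨Z, hZ.trans Set.inter_subset_left, h⟩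

theorem separableSpace : TopologicalSpace.SeparableSpace (strip X) := by
  obtain ⟨Z, -, h⟩ := exists_countable_dense_subset (dense_univ (X := strip X))
  exact ⟨Z, h⟩

theorem mk_axis : #(axis X) = #X := by
  refine Cardinal.mk_congr (Equiv.ofBijective (fun p => ⟨p.1.1.x, ?_⟩) ⟨?_, ?_⟩)
  · rcases p.1.2 with h | h
    · exact h.1
    · exact absurd p.2 h.1.ne'
  · intro p q h
    exact Subtype.ext (injective_coord (Prod.ext (congrArg Subtype.val h)
      (p.2.trans q.2.symm)))
  · intro x
    exact ⟨⟨⟨⟨x, 0, le_rfl⟩, Or.inl ⟨x.2, rfl⟩⟩, rfl⟩, rfl⟩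

theorem isDiscrete_axis : IsDiscrete (axis X) := by
  refine (isClosed_isDiscrete_of_locally_finite fun p => ?_).2
  rcases mem_axis_or_mem_upper p with hp | hp
  · refine ⟨_, (isOpen_tangentNhd hp one_pos).mem_nhds (self_mem_tangentNhd p 1),
      (Set.finite_singleton p).subset ?_⟩
    rintro q ⟨hq, hqp⟩
    refine (mem_tangentNhd.1 hqp).resolve_right fun h => ?_
    rw [show q.1.y = 0 from hq] at h
    nlinarith [sq_nonneg (q.1.x - p.1.x)]
  · refine ⟨_, isOpen_upper.mem_nhds hp, Set.finite_empty.subset ?_⟩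
    rintro q ⟨hq, hqp⟩
    exact hqp.ne' hq

theorem extent_strip (hX : ℵ₀ ≤ #X) : extent (strip X) = #X := by
  refine extent_eq_of_le hX (fun D _ hD => ?_) _ isClosed_axis isDiscrete_axis mk_axis.ge
  have hc : (D ∩ upper X).Countable :=
    (isLindelof_of_subset_upper Set.inter_subset_right).countable_of_isDiscrete
      (hD.mono Set.inter_subset_left)
  have h1 : D ⊆ axis X ∪ (D ∩ upper X) := fun p hp =>
    (mem_axis_or_mem_upper p).imp id fun h => ⟨hp, h⟩
  refine (Cardinal.mk_le_mk_of_subset h1).trans ((Cardinal.mk_union_le _ _).trans ?_)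
  rw [mk_axis]
  exact (add_le_add_right hc.le_aleph0 _).trans (Cardinal.add_eq_left hX hX).le

/-- A tangent disc of half the size lies well inside the given tangent disc. -/
theorem mem_disc_of_close {a b s t r : ℝ} (h : a ^ 2 + (b - r / 2) ^ 2 < (r / 2) ^ 2)
    (hst : (s - a) ^ 2 + (t - b) ^ 2 < (t / 10) ^ 2) (ht : 0 < t) :
    s ^ 2 + (t - r) ^ 2 < r ^ 2 := by
  have h1 : |t - b| < t / 10 :=
    abs_lt_of_sq_lt_sq (by nlinarith [sq_nonneg (s - a)]) (by positivity)
  obtain ⟨h2, h3⟩ := abs_lt.1 h1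
  have hb : 0 < b := by linarith
  have hbr : b < r := by nlinarith [sq_nonneg a]
  -- This is (u + v)² ≤ (1 + 1/4)u² + (1 + 4)v² in each coordinate. The target amounts to s² + t² <
  -- 2rt, and the bounds on b and t leave room to spare.
  have hs : s ^ 2 + t ^ 2 ≤ 5 / 4 * (a ^ 2 + b ^ 2) + 5 * ((s - a) ^ 2 + (t - b) ^ 2) := by
    nlinarith [sq_nonneg (a - 4 * (s - a)), sq_nonneg (b - 4 * (t - b))]
  have hab : a ^ 2 + b ^ 2 < r * b := by linarith
  have htr : t < 10 / 9 * r := by linarith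
  have h5 : t * t < 10 / 9 * r * t := by nlinarith
  have h6 : r * b < r * (11 / 10 * t) := by nlinarith
  nlinarith

/-- The offsets satisfy a² < ry and b² < 2εy with y < 2ε, hence (a - b)² < 2ry + 4εy ≤ 6y < 12ε. -/
theorem not_mem_both_discs {a b y r ε δ : ℝ} (hr : r ≤ 1) (hε : 0 < ε) (hε1 : ε ≤ 1)
    (hδ : 12 * ε ≤ δ ^ 2) (hab : δ ^ 2 ≤ (a - b) ^ 2)
    (ha : a ^ 2 + (y - r / 2) ^ 2 < (r / 2) ^ 2) (hb : b ^ 2 + (y - ε) ^ 2 < ε ^ 2) : False := by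
  have hy : 0 < y := by nlinarith [sq_nonneg b, sq_nonneg y]
  have hy2 : y < 2 * ε := by nlinarith [sq_nonneg b]
  have h1 : (a - b) ^ 2 ≤ 2 * a ^ 2 + 2 * b ^ 2 := by nlinarith [sq_nonneg (a + b)]
  have h2 : r * y ≤ y := by nlinarith
  have h3 : ε * y ≤ y := by nlinarith
  nlinarith [sq_nonneg y]

theorem exists_isOpen_disjoint_closure {K : Set (strip X)} (hK : IsClosed K) {p : strip X}
    (hp : p ∈ upper X) (hpK : p ∉ K) :
    ∃ W, IsOpen W ∧ p ∈ W ∧ Disjoint (closure W) K := by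
  have hs := hK.isOpen_compl.mem_nhds hpK
  rw [nhds_eq_comap_coord hp] at hs
  obtain ⟨u, hu, hus⟩ := hs
  obtain ⟨N, hN, hNc, hNu⟩ := exists_mem_nhds_isClosed_subset hu
  refine ⟨coord ⁻¹' interior N, isOpen_interior.preimage continuous_coord,
    mem_interior_iff_mem_nhds.2 hN, Set.disjoint_left.2 fun q hq => hus (hNu ?_)⟩
  exact closure_minimal (Set.preimage_mono interior_subset) (hNc.preimage continuous_coord) hq

/-- Above the axis, regularity and the Lindelöf property suffice. The axis points of H are sorted by
a closed F k containing the abscissa and a radius r n whose tangent disc misses K. Half-size discs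
over one class have a union whose closure misses K. -/
theorem hasSeparatingCover (hX : #X < pseudoIntersectionNumber) {H K : Set (strip X)}
    (hK : IsClosed K) (hHK : Disjoint H K) : HasSeparatingCover H K := by
  obtain ⟨F, hF, hFH⟩ := exists_isClosed_forall_mem_iff hX
    {x | ∃ p ∈ H, p ∈ axis X ∧ p.1.x = x}
  have hFK : ∀ z ∈ K, z ∈ axis X → ∀ k, z.1.x ∉ F k := by
    intro z hz hza k hzk
    have hzX : z.1.x ∈ X := by
      rcases z.2 with h | h
      exacts [h.1, absurd hza h.1.ne']
    obtain ⟨p, hpH, hpa, hpz⟩ := (hFH _ hzX).2 ⟨k, hzk⟩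
    have : p = z := injective_coord (Prod.ext hpz (hpa.trans hza.symm))
    exact Set.disjoint_left.1 hHK hpH (this ▸ hz)
  have hW : ∀ p : strip X, ∃ W, IsOpen W ∧ Disjoint (closure W) K ∧
      (p ∈ H ∩ upper X → p ∈ W) := by
    intro p
    by_cases hp : p ∈ H ∩ upper X
    · obtain ⟨W, h1, h2, h3⟩ :=
        exists_isOpen_disjoint_closure hK hp.2 (Set.disjoint_left.1 hHK hp.1)
      exact ⟨W, h1, h3, fun _ => h2⟩
    · exact ⟨∅, isOpen_empty, by simp, fun h => absurd h hp⟩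
  choose W hWo hWK hWp using hW
  obtain ⟨t, htc, -, hHt⟩ :=
    (isLindelof_of_subset_upper (T := H ∩ upper X) Set.inter_subset_right).elim_nhds_subcover W
      fun p hp => (hWo p).mem_nhds (hWp p hp)
  let r : ℕ → ℝ := fun n => 1 / ((n : ℝ) + 1)
  have hr : ∀ n, 0 < r n := fun n => Nat.one_div_pos_of_nat
  have hr1 : ∀ n, r n ≤ 1 := fun n => by
    refine (div_le_one (by positivity)).2 ?_
    have : (0 : ℝ) ≤ n := n.cast_nonneg
    linarith
  let A : ℕ × ℕ → Set (strip X) := fun c => {p | p ∈ H ∧ p ∈ axis X ∧ p.1.x ∈ F c.2 ∧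
    ∀ q : strip X, q.1 ∈ disc p.1.x (r c.1) (r c.1) → q ∉ K}
  let N : ℕ × ℕ → Set (strip X) := fun c => ⋃ p ∈ A c, tangentNhd p (r c.1 / 2)
  refine hasSeparatingCover_of_countable (C := W '' t ∪ Set.range N)
    ((htc.image W).union (Set.countable_range N)) (fun p hp => ?_) ?_
  · rcases mem_axis_or_mem_upper p with hpa | hpu
    · obtain ⟨ρ, hρ, hρK⟩ := exists_disc_subset_of_mem_nhds hpa
        (hK.isOpen_compl.mem_nhds (Set.disjoint_left.1 hHK hp))
      obtain ⟨n, hn⟩ := exists_nat_one_div_lt hρ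
      have hpX : p.1.x ∈ X := by
        rcases p.2 with h | h
        exacts [h.1, absurd hpa h.1.ne']
      obtain ⟨k, hk⟩ := (hFH _ hpX).1 ⟨p, hp, hpa, rfl⟩
      refine ⟨N (n, k), Or.inr ⟨_, rfl⟩, Set.mem_iUnion₂.2 ⟨p, ⟨hp, hpa, hk, fun q hq => ?_⟩,
        self_mem_tangentNhd p _⟩⟩
      exact hρK q (tangent_subset_of_le hn.le hq)
    · obtain ⟨q, hq, hpq⟩ := Set.mem_iUnion₂.1 (hHt ⟨hp, hpu⟩)
      exact ⟨W q, Or.inl ⟨q, hq, rfl⟩, hpq⟩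
  · rintro _ (⟨p, -, rfl⟩ | ⟨⟨n, k⟩, rfl⟩)
    · exact ⟨hWo p, hWK p⟩
    · refine ⟨isOpen_biUnion fun p hp => isOpen_tangentNhd hp.2.1 (half_pos (hr n)), ?_⟩
      refine Set.disjoint_right.2 fun z hzK hz => ?_
      rw [mem_closure_iff_nhds] at hz
      rcases mem_axis_or_mem_upper z with hza | hzu
      · obtain ⟨δ, hδ, hδF⟩ := Metric.isOpen_iff.1 (hF k).isOpen_compl z.1.x (hFK z hzK hza k)
        let ε := min 1 (δ ^ 2 / 12)
        have hε : 0 < ε := lt_min one_pos (by positivity)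
        have hε2 : 12 * ε ≤ δ ^ 2 := by linarith [min_le_right 1 (δ ^ 2 / 12)]
        obtain ⟨q, hqz, hqN⟩ := hz _ ((isOpen_tangentNhd hza hε).mem_nhds
          (self_mem_tangentNhd z ε))
        obtain ⟨p, ⟨hpH, hpa, hpF, -⟩, hqp⟩ := Set.mem_iUnion₂.1 hqN
        rw [mem_tangentNhd] at hqz hqp
        rcases hqz with rfl | hqz
        · rcases hqp with rfl | hqp
          · exact Set.disjoint_left.1 hHK hpH hzK
          · rw [show q.1.y = 0 from hza] at hqp
            nlinarith [sq_nonneg (q.1.x - p.1.x)]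
        · rcases hqp with rfl | hqp
          · rw [show q.1.y = 0 from hpa] at hqz
            nlinarith [sq_nonneg (q.1.x - z.1.x)]
          · refine not_mem_both_discs (hr1 n) hε (min_le_left _ _) hε2 ?_ hqp hqz
            have : δ ≤ |p.1.x - z.1.x| := by
              by_contra! hlt
              exact hδF (Metric.mem_ball.2 hlt) hpF
            rw [sub_sub_sub_cancel_left, ← sq_abs (z.1.x - p.1.x), abs_sub_comm]
            exact pow_le_pow_left₀ hδ.le this 2
      -- If `z` were this close to a half-size disc, it would lie in the full disc, which misses
      -- `K`.
      · have hzy : 0 < z.1.y := hzu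
        obtain ⟨q, hqz, hqN⟩ := hz _ (((isOpen_disc z.1.x z.1.y (z.1.y / 10)).preimage
          continuous_subtype_val).mem_nhds (by
            show (z.1.x - z.1.x) ^ 2 + (z.1.y - z.1.y) ^ 2 < (z.1.y / 10) ^ 2
            simpa using pow_pos (show 0 < z.1.y / 10 by positivity) 2))
        have hqz' : (q.1.x - z.1.x) ^ 2 + (q.1.y - z.1.y) ^ 2 < (z.1.y / 10) ^ 2 := hqz
        obtain ⟨p, ⟨hpH, hpa, hpF, hpK⟩, hqp⟩ := Set.mem_iUnion₂.1 hqN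
        rcases mem_tangentNhd.1 hqp with rfl | hqp
        · rw [show q.1.y = 0 from hpa] at hqz'
          nlinarith [sq_nonneg (q.1.x - z.1.x)]
        · refine hpK z (mem_disc_of_close hqp ?_ hzy) hzK
          rw [sub_sub_sub_cancel_right]
          nlinarith

theorem t4Space (hX : #X < pseudoIntersectionNumber) : T4Space (strip X) := by
  have : NormalSpace (strip X) := ⟨fun H K hH hK hHK => hasSeparatingCovers_iff_separatedNhds.1
    ⟨hasSeparatingCover hX hK hHK, hasSeparatingCover hX hH hHK.symm⟩⟩
  exact {}

theorem isASpace_strip (h0 : ℵ₀ < pseudoIntersectionNumber)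
    (hX : #X < pseudoIntersectionNumber) : IsASpace (strip X) := by
  have := t4Space hX
  exact isASpace_of_subcover h0 (fun Y hY => exists_countable_dense_subset hY) fun U hU =>
    exists_subcover_of_isLindelof h0 (mk_axis.trans_lt hX)
      (isLindelof_of_subset_upper subset_rfl) mem_axis_or_mem_upper hU

end NiemytzkiPlane

theorem mainTheorem2 (hp : ℵ₁ < pseudoIntersectionNumber) :
    (∃ (S : Type) (_ : TopologicalSpace S),
      T4Space S ∧ InCountableDiscreteWeb S ∧ extent S = ℵ₁) ∧
    (∀ X : Set ℝ, #X = ℵ₁ →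
      T4Space (NiemytzkiPlane.strip X) ∧
      TopologicalSpace.SeparableSpace (NiemytzkiPlane.strip X) ∧
      IsASpace (NiemytzkiPlane.strip X) ∧
      InCountableDiscreteWeb (NiemytzkiPlane.strip X) ∧
      extent (NiemytzkiPlane.strip X) = ℵ₁) ∧
    (∀ F : Set (Set ℕ), IsAlmostDisjointFamily F → #F = ℵ₁ →
      TopologicalSpace.SeparableSpace (PsiSpace F) ∧
      IsASpace (PsiSpace F) ∧
      InCountableDiscreteWeb (PsiSpace F) ∧
      extent (PsiSpace F) = ℵ₁) ∧
    (∃ F : Set (Set ℕ), IsAlmostDisjointFamily F ∧ #F = ℵ₁ ∧ T4Space (PsiSpace F)) := by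
  have h01 : ℵ₀ ≤ ℵ₁ := Cardinal.aleph0_le_aleph 1
  have h0 : ℵ₀ < pseudoIntersectionNumber := h01.trans_lt hp
  have hPsi : ∀ F : Set (Set ℕ), IsAlmostDisjointFamily F → #F = ℵ₁ →
      TopologicalSpace.SeparableSpace (PsiSpace F) ∧ IsASpace (PsiSpace F) ∧
      InCountableDiscreteWeb (PsiSpace F) ∧ extent (PsiSpace F) = ℵ₁ := by
    intro F hF hF1
    have hs := PsiSpace.separableSpace hF
    have ha := PsiSpace.isASpace h0 hF (hF1.trans_lt hp)
    exact ⟨hs, ha, ha.inCountableDiscreteWeb, (PsiSpace.extent_eq (h01.trans hF1.ge)).trans hF1⟩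
  obtain ⟨F, hF, hF1, hF4⟩ := exists_isAlmostDisjointFamily_t4Space hp
  refine ⟨⟨PsiSpace F, inferInstance, hF4, (hPsi F hF hF1).2.2⟩, fun X hX => ?_, hPsi,
    F, hF, hF1, hF4⟩
  have hs := NiemytzkiPlane.separableSpace (X := X)
  have ha := NiemytzkiPlane.isASpace_strip h0 (hX.trans_lt hp)
  exact ⟨NiemytzkiPlane.t4Space (hX.trans_lt hp), hs, ha, ha.inCountableDiscreteWeb,
    (NiemytzkiPlane.extent_strip (h01.trans hX.ge)).trans hX⟩
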